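/- Let $d\ge 2$, $0\le r_0<r_1\le\infty$ and $A(r_0,r_1)=\{x\in\mathbb{R}^d : r_0<|x|<r_1\}$. For each $k\in\mathbb{N}_0$ let $Y_{k,l}$, $l=1,\dots,a_k$, be a basis of the ($a_k$-dimensional) complex vector space of harmonic homogeneous polynomials of degree $k$ in $d$ variables which is orthonormal with respect to $\langle g,h\rangle=\int_{\mathbb{S}^{d-1}}g(\theta)\overline{h(\theta)}\,d\theta$, where $d\theta$ is the surface measure on the unit sphere $\mathbb{S}^{d-1}$. Let $\tau\ge 0$ and let $f:A(r_0,r_1)\to\mathbb{C}$ be polyharmonic of infinite order and type $\tau$, that is, $f$ is $C^\infty$ and for every compact $K\subset A(r_0,r_1)$ and every $\varepsilon>0$ there is a constant $C_{K,\varepsilon}>0$ such that $$\max_{x\in K}|\Delta^p f(x)|\le C_{K,\varepsilon}\,(2p)!\,(\tau+\varepsilon)^{2p}\qquad\text{for all }p\in\mathbb{N}_0 .$$ For $v\in(\log r_0,\log r_1)$ (with $\log 0=-\infty$, $\log\infty=\infty$) put $$\widetilde f_{k,l}(v)=f_{k,l}(e^v),\qquad f_{k,l}(r)=\int_{\mathbb{S}^{d-1}}f(r\theta)\overline{Y_{k,l}(\theta)}\,d\theta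 ,$$ and, with $\lambda_{2j}=k+2j$ and $\lambda_{2j+1}=-k-d+2+2j$ for $j\in\mathbb{N}_0$, let $$D^{(n)}g=\Big(\frac{d}{dv}-\lambda_0\Big)\cdots\Big(\frac{d}{dv}-\lambda_{n-1}\Big)g,\qquad D^{(0)}g=g .$$ Then every $\widetilde f_{k,l}$ is $C^\infty$ on $(\log r_0,\log r_1)$, and for every $v_0\in(\log r_0,\log r_1)$ and every $\varepsilon>0$ there is a constant $C>0$ such that $$\big|D^{(n)}\widetilde f_{k,l}(v_0)\big|\le C\cdot n!\cdot\big[e^{v_0}(\tau+\varepsilon)\big]^n$$ for all $n\in\mathbb{N}_0$, all $k\in\mathbb{N}_0$ and all $l=1,\dots,a_k$. -/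

import Mathlib

open MeasureTheory
open scoped ENNReal ContDiff InnerProductSpace ComplexConjugate

noncomputable section

/-- The annular region `A(r₀, r₁) = {x ∈ ℝᵈ : r₀ < |x| < r₁}`, where `0 ≤ r₀` and `r₁ ≤ ∞`. -/
def annulus (d : ℕ) (r₀ r₁ : ℝ≥0∞) : Set (EuclideanSpace ℝ (Fin d)) :=
  {x | r₀ < ENNReal.ofReal ‖x‖ ∧ ENNReal.ofReal ‖x‖ < r₁}

/-- The interval `(log r₀, log r₁)`, where `log 0 = -∞` and `log ∞ = ∞`. -/
def logInterval (r₀ r₁ : ℝ≥0∞) : Set ℝ :=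
  {v | ENNReal.log r₀ < (v : EReal) ∧ (v : EReal) < ENNReal.log r₁}

/-- `f` is polyharmonic of infinite order and type `τ` on the (open) set `G`: it is smooth on `G`
and `max_K |Δᵖ f| ≤ C_{K,ε} (2p)! (τ + ε)^{2p}` for all compact `K ⊆ G`, `ε > 0` and all `p`. -/
def PolyharmonicOfInfiniteOrder {d : ℕ} (τ : ℝ) (G : Set (EuclideanSpace ℝ (Fin d)))
    (f : EuclideanSpace ℝ (Fin d) → ℂ) : Prop :=
  ContDiffOn ℝ ∞ f G ∧
    ∀ K ⊆ G, IsCompact K → ∀ ε : ℝ, 0 < ε → ∃ C : ℝ, 0 < C ∧ ∀ p : ℕ, ∀ x ∈ K,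
      ‖((fun g : EuclideanSpace ℝ (Fin d) → ℂ => Laplacian.laplacian g)^[p] f) x‖ ≤ C * (2 * p).factorial * (τ + ε) ^ (2 * p)

/-- The Laplacian `∑ᵢ ∂²/∂xᵢ²` on polynomials in `d` variables with complex coefficients. -/
def polyLaplacian (d : ℕ) : MvPolynomial (Fin d) ℂ →ₗ[ℂ] MvPolynomial (Fin d) ℂ :=
  ∑ i : Fin d, (MvPolynomial.pderiv i).toLinearMap ∘ₗ (MvPolynomial.pderiv i).toLinearMap

/-- The space of harmonic homogeneous polynomials of degree `k` in `d` variables. -/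
def harmonicPolys (d k : ℕ) : Submodule ℂ (MvPolynomial (Fin d) ℂ) :=
  MvPolynomial.homogeneousSubmodule (Fin d) ℂ k ⊓ LinearMap.ker (polyLaplacian d)

/-- The dimension `a_k` of the space of harmonic homogeneous polynomials of degree `k`. -/
def harmonicDim (d k : ℕ) : ℕ := Module.finrank ℂ (harmonicPolys d k)

/-- The value of a polynomial at a point of `ℝᵈ`. -/
def polyVal {d : ℕ} (P : MvPolynomial (Fin d) ℂ) (x : EuclideanSpace ℝ (Fin d)) : ℂ :=
  MvPolynomial.eval (fun i => (x i : ℂ)) P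

/-- The surface measure `dθ` on the unit sphere of `ℝᵈ`; its total mass is `d` times the volume
of the unit ball. -/
def sphereMeasure (d : ℕ) : Measure (Metric.sphere (0 : EuclideanSpace ℝ (Fin d)) 1) :=
  (volume : Measure (EuclideanSpace ℝ (Fin d))).toSphere

/-- The scalar product `⟨f, g⟩ = ∫ f(θ) conj(g(θ)) dθ` over the unit sphere. -/
def sphereInner {d : ℕ} (f g : EuclideanSpace ℝ (Fin d) → ℂ) : ℂ :=
  ∫ θ, f θ * conj (g θ) ∂(sphereMeasure d)

/-- A choice, for every degree `k`, of a basis `Y_{k,l}`, `l = 1, …, a_k`, of the space of harmonic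
homogeneous polynomials of degree `k` that is orthonormal for the scalar product on the sphere. -/
structure SphericalHarmonicBasis (d : ℕ) where
  Y : (k : ℕ) → Module.Basis (Fin (harmonicDim d k)) ℂ (harmonicPolys d k)
  orthonormal : ∀ k l m,
    sphereInner (polyVal (Y k l : MvPolynomial (Fin d) ℂ))
      (polyVal (Y k m : MvPolynomial (Fin d) ℂ)) = if l = m then 1 else 0

/-- The Fourier-Laplace coefficient `f_{k,l}(r) = ∫ f(rθ) conj(Y_{k,l}(θ)) dθ`. -/
def fourierLaplaceCoeff {d : ℕ} (B : SphericalHarmonicBasis d)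
    (f : EuclideanSpace ℝ (Fin d) → ℂ) (k : ℕ) (l : Fin (harmonicDim d k)) (r : ℝ) : ℂ :=
  ∫ θ : Metric.sphere (0 : EuclideanSpace ℝ (Fin d)) 1,
    f (r • (θ : EuclideanSpace ℝ (Fin d))) *
      conj (polyVal (B.Y k l : MvPolynomial (Fin d) ℂ) (θ : EuclideanSpace ℝ (Fin d)))
    ∂(sphereMeasure d)

/-- `f̃_{k,l}(v) = f_{k,l}(e^v)`. -/
def logFourierLaplaceCoeff {d : ℕ} (B : SphericalHarmonicBasis d)
    (f : EuclideanSpace ℝ (Fin d) → ℂ) (k : ℕ) (l : Fin (harmonicDim d k)) (v : ℝ) : ℂ :=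
  fourierLaplaceCoeff B f k l (Real.exp v)

/-- The exponents `λ_{2j} = k + 2j` and `λ_{2j+1} = -k - d + 2 + 2j`
(here `2j = 2 * (n / 2)` with the quotient of natural numbers). -/
def exponent (d k n : ℕ) : ℝ :=
  if n % 2 = 0 then (k : ℝ) + (2 * (n / 2) : ℕ)
  else -(k : ℝ) - (d : ℝ) + 2 + (2 * (n / 2) : ℕ)

/-- `D^{(n)} g = (d/dv - λ₀) ⋯ (d/dv - λ_{n-1}) g`. The factors commute on smooth functions;
the factor with `λ_n` is applied last when passing from `n` to `n + 1`. -/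
def genDeriv (lam : ℕ → ℝ) (g : ℝ → ℂ) : ℕ → ℝ → ℂ
  | 0 => g
  | n + 1 => fun v => deriv (genDeriv lam g n) v - (lam n : ℂ) * genDeriv lam g n v

end

open Set Filter Topology

/-! In the variable `v = log r`, the operator `r² Δ` acts on the component along a harmonic of
degree `k` as `(d/dv - k)(d/dv + k + d - 2)`. Since `d/dv - λ - 2p` acts on `e^{2pv} u` as `d/dv -
λ` acts on `u`, the shifted exponents give `D^{(2p)} f̃_{k,l} = e^{2pv} (Δ^p f)~_{k,l}`
(`genDeriv_radialCoeff`). For even `n` the bound is then the growth condition on `Δ^p f`, combined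
with an `L¹` bound on `Y_{k,l}` that orthonormality makes independent of `k` and `l`.

For odd `n` there is one more factor `d/dv - k`, and the growth condition controls no first
derivatives. With `g` the coefficient of `Δ^p f`, both `g` and `(d/dv - k)(d/dv + k + d - 2) g`, the
latter coming from `Δ^{p+1} f`, are controlled. `norm_deriv_sub_mul_le` interpolates between them
with constants free of `k`. The price is a factor `2p + 2` from `(2p + 2)!`, absorbed by enlarging
`τ + ε/2` to `τ + ε`.

The radial form of `Δ` (`radialCoeff_laplacian`) is obtained without spherical coordinates: the
angular part is a sum of squares of infinitesimal rotations, which are skew for the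
rotation-invariant sphere measure. -/

/-- Differentiation under the integral sign over a compact space. -/
theorem hasDerivAt_integral_of_continuousOn_prod {X : Type*} [TopologicalSpace X] [CompactSpace X]
    [MeasurableSpace X] [BorelSpace X] [SecondCountableTopology X] (μ : Measure X)
    [IsFiniteMeasure μ]
    {F F' : ℝ → X → ℂ} {U : Set ℝ} (hU : IsOpen U) {t₀ : ℝ} (ht₀ : t₀ ∈ U)
    (hF : ContinuousOn (Function.uncurry F) (U ×ˢ univ))
    (hF' : ContinuousOn (Function.uncurry F') (U ×ˢ univ))
    (hderiv : ∀ t ∈ U, ∀ x, HasDerivAt (fun s => F s x) (F' t x) t) :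
    HasDerivAt (fun t => ∫ x, F t x ∂μ) (∫ x, F' t₀ x ∂μ) t₀ := by
  obtain ⟨δ, hδ, hball⟩ := Metric.nhds_basis_closedBall.mem_iff.1 (hU.mem_nhds ht₀)
  have hslice : ∀ {H : ℝ → X → ℂ}, ContinuousOn (Function.uncurry H) (U ×ˢ univ) →
      ∀ t ∈ U, Continuous (H t) := fun {H} hH t ht =>
    hH.comp_continuous (f := fun x => (t, x)) (by fun_prop) fun x => ⟨ht, mem_univ _⟩
  have hint : ∀ {g : X → ℂ}, Continuous g → Integrable g μ := fun {g} hg => by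
    obtain ⟨C, hC⟩ := isCompact_univ.exists_bound_of_continuousOn hg.continuousOn
    exact .of_bound hg.aestronglyMeasurable C (.of_forall fun x => hC x (mem_univ _))
  obtain ⟨C, hC⟩ := ((isCompact_closedBall t₀ δ).prod (isCompact_univ (X := X))
    ).exists_bound_of_continuousOn (hF'.mono (prod_mono hball subset_rfl))
  refine (hasDerivAt_integral_of_dominated_loc_of_deriv_le (bound := fun _ => C)
    (Metric.closedBall_mem_nhds t₀ hδ) ?_ (hint (hslice hF _ ht₀))
    (hslice hF' _ ht₀).aestronglyMeasurable ?_ (integrable_const _) ?_).2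
  · filter_upwards [hU.mem_nhds ht₀] with t ht using (hslice hF t ht).aestronglyMeasurable
  · exact .of_forall fun x t ht => hC (t, x) ⟨ht, mem_univ _⟩
  · exact .of_forall fun x t ht => hderiv t (hball ht) x

/-! ### Rotation invariance of the sphere measure and integration by parts. -/

section Sphere

variable {d : ℕ}

local notation "E" => EuclideanSpace ℝ (Fin d)
local notation "S" => Metric.sphere (0 : EuclideanSpace ℝ (Fin d)) 1

instance isFiniteMeasure_sphereMeasure (d : ℕ) : IsFiniteMeasure (sphereMeasure d) := by
  unfold sphereMeasure; infer_instance

theorem Continuous.integrable_sphereMeasure {g : S → ℂ} (hg : Continuous g) :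
    Integrable g (sphereMeasure d) := by
  obtain ⟨C, hC⟩ := isCompact_univ.exists_bound_of_continuousOn hg.continuousOn
  exact .of_bound hg.aestronglyMeasurable C (.of_forall fun x => hC x (mem_univ _))

/-- The map of the unit sphere induced by a linear isometry. -/
noncomputable def LinearIsometryEquiv.sphereMap (e : E ≃ₗᵢ[ℝ] E) (θ : S) : S :=
  ⟨e θ, by simp⟩

theorem LinearIsometryEquiv.continuous_sphereMap (e : E ≃ₗᵢ[ℝ] E) : Continuous e.sphereMap :=
  (e.continuous.comp continuous_subtype_val).subtype_mk _

-- The surface measure of `s` is `d` times the volume of the cone `(0,1) • s`; a linear isometry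
-- preserves volume and carries cones to cones.
open scoped Pointwise in
theorem LinearIsometryEquiv.measurePreserving_sphereMap (e : E ≃ₗᵢ[ℝ] E) :
    MeasurePreserving e.sphereMap (sphereMeasure d) (sphereMeasure d) := by
  refine ⟨e.continuous_sphereMap.measurable, ?_⟩
  ext s hs
  have hm := e.continuous_sphereMap.measurable
  rw [Measure.map_apply hm hs, sphereMeasure, Measure.toSphere_apply' _ (hm hs),
    Measure.toSphere_apply' _ hs,
    ← (e.measurePreserving).measure_preimage_equiv (f := e.toMeasurableEquiv)
      (Ioo (0 : ℝ) 1 • (Subtype.val '' s))]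
  congr 2
  ext x
  simp only [Set.mem_smul, mem_image, mem_preimage]
  constructor
  · rintro ⟨r, hr, _, ⟨θ, hθ, rfl⟩, rfl⟩
    exact ⟨r, hr, _, ⟨_, hθ, rfl⟩, by simp [LinearIsometryEquiv.sphereMap]⟩
  · rintro ⟨r, hr, _, ⟨θ, hθ, rfl⟩, h⟩
    refine ⟨r, hr, _, ⟨e.symm.sphereMap θ, ?_, rfl⟩, ?_⟩
    · convert hθ
      ext1
      simp [LinearIsometryEquiv.sphereMap]
    · apply e.injective
      simpa [LinearIsometryEquiv.sphereMap] using h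

theorem LinearIsometryEquiv.integral_comp_sphereMap (e : E ≃ₗᵢ[ℝ] E) {g : S → ℂ}
    (hg : Continuous g) :
    ∫ θ, g (e.sphereMap θ) ∂(sphereMeasure d) = ∫ θ, g θ ∂(sphereMeasure d) := by
  conv_rhs => rw [← e.measurePreserving_sphereMap.map_eq]
  rw [integral_map e.continuous_sphereMap.measurable.aemeasurable hg.aestronglyMeasurable]

/-- Along the flow `y' = A y`, the derivative of `‖y‖²` is `2⟪y, A y⟫ = 0`. -/
theorem norm_exp_smul_apply {A : E →L[ℝ] E} (hA : ∀ x, ⟪A x, x⟫_ℝ = 0) (t : ℝ) (x : E) :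
    ‖NormedSpace.exp (t • A) x‖ = ‖x‖ := by
  have hd : ∀ t : ℝ, HasDerivAt (fun t : ℝ => NormedSpace.exp (t • A) x)
      (A (NormedSpace.exp (t • A) x)) t := fun t =>
    (hasDerivAt_exp_smul_const' A t).clm_apply (hasDerivAt_const t x) |>.congr_deriv (by simp)
  have h2 : ∀ t : ℝ, HasDerivAt (fun t : ℝ => ‖NormedSpace.exp (t • A) x‖ ^ 2) 0 t := fun t =>
    (hd t).norm_sq.congr_deriv (by rw [real_inner_comm, hA, mul_zero])
  have h3 := is_const_of_deriv_eq_zero (fun t => (h2 t).differentiableAt) (fun t => (h2 t).deriv) t 0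
  have h0 : NormedSpace.exp ((0 : ℝ) • A) = 1 := by
    rw [zero_smul ℝ A]; exact NormedSpace.exp_zero
  rw [h0] at h3
  simpa using h3

/-- The one-parameter group of rotations generated by a skew-symmetric operator. -/
noncomputable def expRotation (A : E →L[ℝ] E) (hA : ∀ x, ⟪A x, x⟫_ℝ = 0) (t : ℝ) : E ≃ₗᵢ[ℝ] E :=
  LinearIsometry.toLinearIsometryEquiv
    ⟨(NormedSpace.exp (t • A) : E →L[ℝ] E).toLinearMap, norm_exp_smul_apply hA t⟩ rfl

/-- The derivative of `f` along the linear vector field `A`. -/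
noncomputable def linDeriv (A : E →L[ℝ] E) (f : E → ℂ) (x : E) : ℂ := fderiv ℝ f x (A x)

theorem ContDiffOn.linDeriv {A : E →L[ℝ] E} {f : E → ℂ} {G : Set E} (hG : IsOpen G)
    (hf : ContDiffOn ℝ ∞ f G) : ContDiffOn ℝ ∞ (linDeriv A f) G :=
  (hf.fderiv_of_isOpen hG (by simp)).clm_apply A.contDiff.contDiffOn

/-- By rotation invariance the integral of `f (c • R t θ) * g (R t θ)` does not depend on `t`; its
derivative at `t = 0` is the sum of the two integrals. -/
theorem integral_linDeriv_mul {A : E →L[ℝ] E} (hA : ∀ x, ⟪A x, x⟫_ℝ = 0) {f g : E → ℂ}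
    {G : Set E} (hG : IsOpen G) (hf : ContDiffOn ℝ ∞ f G) (hg : ContDiff ℝ ∞ g) {c : ℝ}
    (hc : ∀ x : E, ‖x‖ = 1 → c • x ∈ G) :
    ∫ θ : S, linDeriv A f (c • (θ : E)) * g θ ∂(sphereMeasure d) =
      -∫ θ : S, f (c • (θ : E)) * linDeriv A g θ ∂(sphereMeasure d) := by
  set R : ℝ → E →L[ℝ] E := fun t => NormedSpace.exp (t • A)
  have hRc : Continuous R := by
    refine continuous_iff_continuousAt.2 fun t => (hasDerivAt_exp_smul_const' A t).continuousAt
  have hRd : ∀ (x : E) (t : ℝ), HasDerivAt (fun t : ℝ => R t x) (A (R t x)) t := fun x t =>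
    (hasDerivAt_exp_smul_const' A t).clm_apply (hasDerivAt_const t x) |>.congr_deriv (by simp [R])
  have hmem : ∀ (t : ℝ) (θ : S), c • R t θ ∈ G := fun t θ =>
    hc _ (by rw [norm_exp_smul_apply hA]; simp)
  have hcR : Continuous fun p : ℝ × S => R p.1 p.2 := by fun_prop
  have hcont : ∀ {h : E → ℂ}, ContDiffOn ℝ ∞ h G →
      Continuous fun p : ℝ × S => h (c • R p.1 p.2) := fun {h} hh =>
    hh.continuousOn.comp_continuous (by fun_prop) fun p => hmem _ _
  have hgA : Continuous (linDeriv A g) := by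
    have := (contDiffOn_univ.2 hg).linDeriv (A := A) isOpen_univ
    exact (contDiffOn_univ.1 this).continuous
  have hf1 := hcont hf
  have hf2 := hcont (hf.linDeriv (A := A) hG)
  have hgc := hg.continuous
  have key := hasDerivAt_integral_of_continuousOn_prod (sphereMeasure d)
    (F := fun t θ => f (c • R t θ) * g (R t θ))
    (F' := fun t θ => linDeriv A f (c • R t θ) * g (R t θ) + f (c • R t θ) * linDeriv A g (R t θ))
    isOpen_univ (mem_univ (0 : ℝ)) (Continuous.continuousOn (by
      exact hf1.mul (hgc.comp hcR))) (Continuous.continuousOn (by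
      exact (hf2.mul (hgc.comp hcR)).add (hf1.mul (hgA.comp hcR)))) (by
      intro t _ θ
      have h1 : HasDerivAt (fun s => f (c • R s θ)) (linDeriv A f (c • R t θ)) t := by
        have hfd : HasFDerivAt f (fderiv ℝ f (c • R t θ)) (c • R t θ) :=
          ((hf.contDiffAt (hG.mem_nhds (hmem t θ))).differentiableAt (by simp)).hasFDerivAt
        have := hfd.comp_hasDerivAt t ((hRd θ t).const_smul c)
        refine this.congr_deriv ?_
        simp [linDeriv]
      have h2 : HasDerivAt (fun s => g (R s θ)) (linDeriv A g (R t θ)) t :=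
        ((hg.differentiable (by simp)) _).hasFDerivAt.comp_hasDerivAt t (hRd θ t)
      exact h1.mul h2)
  have hconst : (fun t => ∫ θ : S, f (c • R t θ) * g (R t θ) ∂(sphereMeasure d)) =
      fun _ => ∫ θ : S, f (c • (θ : E)) * g θ ∂(sphereMeasure d) := by
    funext t
    refine (expRotation A hA t).integral_comp_sphereMap
      (g := fun θ : S => f (c • (θ : E)) * g θ) ?_
    refine Continuous.mul ?_ (hgc.comp continuous_subtype_val)
    exact hf.continuousOn.comp_continuous (by fun_prop) fun θ => hc _ (by simp)
  rw [hconst] at key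
  have h0 := key.unique (hasDerivAt_const _ _)
  have hR0 : R 0 = ContinuousLinearMap.id ℝ E := by
    simp only [R]
    rw [zero_smul ℝ A]; exact NormedSpace.exp_zero
  simp only [hR0, ContinuousLinearMap.coe_id', id_eq] at h0
  rw [integral_add] at h0
  · exact eq_neg_of_add_eq_zero_left h0
  · apply Continuous.integrable_sphereMeasure
    refine Continuous.mul ?_ (hgc.comp continuous_subtype_val)
    exact (hf.linDeriv hG).continuousOn.comp_continuous (by fun_prop) fun θ => hc _ (by simp)
  · apply Continuous.integrable_sphereMeasure
    refine Continuous.mul ?_ (hgA.comp continuous_subtype_val)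
    exact hf.continuousOn.comp_continuous (by fun_prop) fun θ => hc _ (by simp)

end Sphere

/-! ### The angular Laplacian as a sum of squares of plane rotations. -/

section AngularLaplacian

variable {d : ℕ}

local notation "E" => EuclideanSpace ℝ (Fin d)
local notation "S" => Metric.sphere (0 : EuclideanSpace ℝ (Fin d)) 1

/-- The infinitesimal rotation `x ↦ xᵢ eⱼ - xⱼ eᵢ` in the `(i, j)` coordinate plane. -/
noncomputable def planeRotation (i j : Fin d) : E →L[ℝ] E :=
  (EuclideanSpace.proj i : E →L[ℝ] ℝ).smulRight (EuclideanSpace.single j (1 : ℝ)) -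
    (EuclideanSpace.proj j : E →L[ℝ] ℝ).smulRight (EuclideanSpace.single i (1 : ℝ))

theorem planeRotation_apply (i j : Fin d) (x : E) :
    planeRotation i j x =
      x i • EuclideanSpace.single j (1 : ℝ) - x j • EuclideanSpace.single i (1 : ℝ) := by
  simp [planeRotation]

theorem inner_planeRotation_self (i j : Fin d) (x : E) : ⟪planeRotation i j x, x⟫_ℝ = 0 := by
  rw [planeRotation_apply, inner_sub_left, real_inner_smul_left, real_inner_smul_left,
    EuclideanSpace.inner_single_left, EuclideanSpace.inner_single_left]
  simp [mul_comm]

theorem EuclideanSpace.sum_smul_single (x : E) :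
    ∑ i, x i • EuclideanSpace.single i (1 : ℝ) = x := by
  simpa using (EuclideanSpace.basisFun (Fin d) ℝ).sum_repr x

/-- The square of the `(i, j)` rotation is minus the projection onto that plane, and each coordinate
lies in `2(d - 1)` ordered pairs `i ≠ j`. This yields the first-order term of the angular Laplacian.
-/
theorem sum_planeRotation_planeRotation (x : E) :
    ∑ i, ∑ j, planeRotation i j (planeRotation i j x) = (-(2 * ((d : ℝ) - 1))) • x := by
  have h : ∀ i j : Fin d, planeRotation i j (planeRotation i j x) =
      (if i = j then (2 * x i) • EuclideanSpace.single i (1 : ℝ) else 0) -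
        x j • EuclideanSpace.single j (1 : ℝ) - x i • EuclideanSpace.single i (1 : ℝ) := by
    intro i j
    by_cases hij : i = j
    · subst hij
      ext m
      simp only [planeRotation_apply, sub_self, map_zero, if_true]
      simp
      split_ifs <;> ring
    · ext m
      simp [planeRotation_apply, hij, Ne.symm hij]
  simp only [h, Finset.sum_sub_distrib, Finset.sum_ite_eq, Finset.mem_univ, if_true,
    Finset.sum_const, Finset.card_univ, Fintype.card_fin, mul_smul, ← Finset.smul_sum,
    EuclideanSpace.sum_smul_single]
  module

theorem linDeriv_linDeriv {A : E →L[ℝ] E} {f : E → ℂ} {x : E} (hf : ContDiffAt ℝ ∞ f x) :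
    linDeriv A (linDeriv A f) x =
      fderiv ℝ (fderiv ℝ f) x (A x) (A x) + fderiv ℝ f x (A (A x)) := by
  have h1 : DifferentiableAt ℝ (fderiv ℝ f) x :=
    (hf.fderiv_right (m := ∞) (by simp)).differentiableAt (by simp)
  have h2 := h1.hasFDerivAt.clm_apply A.hasFDerivAt
  have h3 : fderiv ℝ (linDeriv A f) x = _ := h2.fderiv
  rw [linDeriv, h3]
  simp [add_comm]

theorem laplacian_apply_eq_sum_fderiv (f : E → ℂ) (x : E) :
    Laplacian.laplacian f x = ∑ i : Fin d, fderiv ℝ (fderiv ℝ f) x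
      (EuclideanSpace.single i (1 : ℝ)) (EuclideanSpace.single i (1 : ℝ)) := by
  rw [InnerProductSpace.laplacian_eq_iteratedFDeriv_orthonormalBasis f
    (EuclideanSpace.basisFun (Fin d) ℝ)]
  simp [iteratedFDeriv_two_apply]

theorem ContDiffOn.laplacian {f : E → ℂ} {G : Set E} (hG : IsOpen G)
    (hf : ContDiffOn ℝ ∞ f G) : ContDiffOn ℝ ∞ (Laplacian.laplacian f) G := by
  have h : (Laplacian.laplacian f : E → ℂ) = fun x => ∑ i : Fin d, fderiv ℝ (fderiv ℝ f) x
      (EuclideanSpace.single i (1 : ℝ)) (EuclideanSpace.single i (1 : ℝ)) :=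
    funext fun x => laplacian_apply_eq_sum_fderiv f x
  rw [h]
  refine ContDiffOn.sum fun i _ => ?_
  exact (((hf.fderiv_of_isOpen hG (m := ∞) (by simp)).fderiv_of_isOpen hG (m := ∞)
    (by simp)).clm_apply contDiffOn_const).clm_apply contDiffOn_const

/-- A form of Lagrange's identity. Symmetry of `b` is not needed: summing over ordered pairs makes
the two cross terms equal. -/
theorem sum_bilinear_planeRotation (b : E →L[ℝ] E →L[ℝ] ℂ) (x : E) :
    ∑ i, ∑ j, b (planeRotation i j x) (planeRotation i j x) =
      2 * ((‖x‖ ^ 2 : ℝ) * ∑ i, b (EuclideanSpace.single i (1 : ℝ))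
        (EuclideanSpace.single i (1 : ℝ)) - b x x) := by
  set q : Fin d → Fin d → ℂ := fun i j =>
    b (EuclideanSpace.single i (1 : ℝ)) (EuclideanSpace.single j (1 : ℝ)) with hq
  have hbx : b x x = ∑ i, ∑ j, (x i : ℂ) * x j * q i j := by
    conv_lhs => rw [← EuclideanSpace.sum_smul_single x]
    simp only [map_sum, map_smul, sum_apply, smul_apply,
      Complex.real_smul, Finset.mul_sum, mul_assoc, hq]
    rw [Finset.sum_comm]
    refine Finset.sum_congr rfl fun i _ => Finset.sum_congr rfl fun j _ => by ring
  have hx : ((‖x‖ ^ 2 : ℝ) : ℂ) = ∑ i, (x i : ℂ) ^ 2 := by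
    rw [EuclideanSpace.real_norm_sq_eq]; push_cast; rfl
  have h : ∀ i j : Fin d, b (planeRotation i j x) (planeRotation i j x) =
      (x i : ℂ) ^ 2 * q j j + (x j : ℂ) ^ 2 * q i i - (x i : ℂ) * x j * q i j -
        (x j : ℂ) * x i * q j i := by
    intro i j
    simp only [planeRotation_apply, map_sub, map_smul, sub_apply,
      smul_apply, Complex.real_smul, hq]
    ring
  have hT : ∑ i, ∑ j, (x j : ℂ) * x i * q j i = b x x := by rw [hbx, Finset.sum_comm]
  have hU : ∑ i, ∑ j, (x j : ℂ) ^ 2 * q i i = (∑ i, (x i : ℂ) ^ 2) * ∑ i, q i i := by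
    rw [Finset.sum_comm, Finset.sum_mul_sum]
  simp only [h, Finset.sum_sub_distrib, Finset.sum_add_distrib, hT, hU, ← hbx,
    ← Finset.sum_mul_sum, hx]
  ring

/-- The angular part of the Laplacian, expressed through infinitesimal rotations. -/
theorem sum_linDeriv_planeRotation {f : E → ℂ} {x : E} (hf : ContDiffAt ℝ ∞ f x) :
    ∑ i, ∑ j, linDeriv (planeRotation i j) (linDeriv (planeRotation i j) f) x =
      2 * ((‖x‖ ^ 2 : ℝ) * Laplacian.laplacian f x -
        linDeriv (.id ℝ E) (linDeriv (.id ℝ E) f) x -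
        ((d : ℂ) - 2) * linDeriv (.id ℝ E) f x) := by
  -- With `𝓔` the Euler derivative, `D²f(x, x) = 𝓔²f - 𝓔f`. The resulting `+2𝓔f` turns the
  -- coefficient `-2(d - 1)` into `-2(d - 2)`.
  simp only [linDeriv_linDeriv hf, Finset.sum_add_distrib, ← map_sum,
    sum_planeRotation_planeRotation, sum_bilinear_planeRotation, laplacian_apply_eq_sum_fderiv]
  simp only [map_smul, Complex.real_smul, linDeriv, ContinuousLinearMap.coe_id', id_eq]
  push_cast
  ring

end AngularLaplacian

/-! ### Harmonic polynomials as eigenfunctions of the angular Laplacian. -/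

section HarmonicPolynomials

variable {d : ℕ}

local notation "E" => EuclideanSpace ℝ (Fin d)

theorem hasFDerivAt_polyVal (P : MvPolynomial (Fin d) ℂ) (x : E) :
    HasFDerivAt (polyVal P) (∑ i, polyVal (MvPolynomial.pderiv i P) x •
      (Complex.ofRealCLM ∘L (EuclideanSpace.proj i : E →L[ℝ] ℝ))) x := by
  induction P using MvPolynomial.induction_on with
  | C a =>
    have : (polyVal (MvPolynomial.C a) : E → ℂ) = fun _ => a := by
      funext y; simp [polyVal]
    rw [this]
    exact (hasFDerivAt_const (𝕜 := ℝ) a x).congr_fderiv (by ext v; simp [polyVal])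
  | add P Q hP hQ =>
    have : (polyVal (P + Q) : E → ℂ) = fun y => polyVal P y + polyVal Q y := by
      funext y; simp [polyVal]
    rw [this]
    refine (hP.add hQ).congr_fderiv ?_
    ext v
    simp [polyVal, add_mul, Finset.sum_add_distrib]
  | mul_X P n hP =>
    have : (polyVal (P * MvPolynomial.X n) : E → ℂ) = fun y => polyVal P y * (y n : ℂ) := by
      funext y; simp [polyVal]
    rw [this]
    have hX : HasFDerivAt (fun y : E => (y n : ℂ))
        (Complex.ofRealCLM ∘L (EuclideanSpace.proj n : E →L[ℝ] ℝ)) x :=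
      (Complex.ofRealCLM ∘L (EuclideanSpace.proj n : E →L[ℝ] ℝ)).hasFDerivAt
    refine (hP.mul hX).congr_fderiv ?_
    ext v
    simp only [polyVal, Derivation.leibniz, MvPolynomial.pderiv_X, smul_eq_mul, map_add, map_mul,
      MvPolynomial.eval_X, add_apply, smul_apply,
      sum_apply, ContinuousLinearMap.comp_apply, add_mul,
      Finset.sum_add_distrib, Finset.mul_sum]
    congr 1
    · rw [Finset.sum_eq_single n]
      · simp
      · intro b _ hb
        simp [hb.symm]
      · simp
    · refine Finset.sum_congr rfl fun i _ => by ring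

theorem fderiv_polyVal (P : MvPolynomial (Fin d) ℂ) :
    fderiv ℝ (polyVal P : E → ℂ) = fun x => ∑ i, polyVal (MvPolynomial.pderiv i P) x •
      (Complex.ofRealCLM ∘L (EuclideanSpace.proj i : E →L[ℝ] ℝ)) :=
  funext fun x => (hasFDerivAt_polyVal P x).fderiv

theorem contDiff_polyVal (P : MvPolynomial (Fin d) ℂ) : ContDiff ℝ ∞ (polyVal P : E → ℂ) := by
  induction P using MvPolynomial.induction_on with
  | C a =>
    have : (polyVal (MvPolynomial.C a) : E → ℂ) = fun _ => a := by
      funext y; simp [polyVal]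
    rw [this]
    exact contDiff_const
  | add P Q hP hQ =>
    have : (polyVal (P + Q) : E → ℂ) = fun y => polyVal P y + polyVal Q y := by
      funext y; simp [polyVal]
    rw [this]
    exact hP.add hQ
  | mul_X P n hP =>
    have : (polyVal (P * MvPolynomial.X n) : E → ℂ) = fun y => polyVal P y * (y n : ℂ) := by
      funext y; simp [polyVal]
    rw [this]
    exact hP.mul (Complex.ofRealCLM ∘L (EuclideanSpace.proj n : E →L[ℝ] ℝ)).contDiff

theorem laplacian_polyVal (P : MvPolynomial (Fin d) ℂ) (x : E) :
    Laplacian.laplacian (polyVal P : E → ℂ) x = polyVal (polyLaplacian d P) x := by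
  rw [laplacian_apply_eq_sum_fderiv]
  have h : polyVal (polyLaplacian d P) x =
      ∑ i, polyVal (MvPolynomial.pderiv i (MvPolynomial.pderiv i P)) x := by
    simp [polyVal, polyLaplacian, LinearMap.sum_apply]
  rw [h]
  refine Finset.sum_congr rfl fun i _ => ?_
  have hd := HasFDerivAt.fun_sum (u := Finset.univ) fun (j : Fin d) _ =>
    (hasFDerivAt_polyVal (MvPolynomial.pderiv j P) x).smul_const
      (Complex.ofRealCLM ∘L (EuclideanSpace.proj j : E →L[ℝ] ℝ))
  rw [fderiv_polyVal, hd.fderiv]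
  simp [sum_apply, apply_ite Complex.ofReal]

theorem linDeriv_id_polyVal {P : MvPolynomial (Fin d) ℂ} {k : ℕ} (hP : P.IsHomogeneous k) (x : E) :
    linDeriv (.id ℝ E) (polyVal P) x = k * polyVal P x := by
  have h := congrArg (fun Q => polyVal Q x) hP.sum_X_mul_pderiv
  simp only [polyVal, map_sum, map_mul, MvPolynomial.eval_X, nsmul_eq_mul, map_natCast] at h
  simp only [linDeriv, fderiv_polyVal, polyVal, ← h]
  simp [mul_comm]

theorem linDeriv_conj (A : E →L[ℝ] E) {f : E → ℂ} (hf : ContDiff ℝ ∞ f) :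
    linDeriv A (fun x => conj (f x)) = fun x => conj (linDeriv A f x) := by
  funext x
  have h : HasFDerivAt (fun x => conj (f x)) _ x :=
    Complex.conjCLE.toContinuousLinearMap.hasFDerivAt.comp x
      (hf.differentiable (by simp) x).hasFDerivAt
  simp [linDeriv, h.fderiv]

theorem ContDiff.linDeriv {A : E →L[ℝ] E} {f : E → ℂ} (hf : ContDiff ℝ ∞ f) :
    ContDiff ℝ ∞ (linDeriv A f) :=
  contDiffOn_univ.1 ((contDiffOn_univ.2 hf).linDeriv isOpen_univ)

/-- Spherical harmonics are eigenfunctions of the angular Laplacian. -/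
theorem sum_linDeriv_conj_harmonic {P : MvPolynomial (Fin d) ℂ} {k : ℕ}
    (hP : P ∈ harmonicPolys d k) (x : E) :
    ∑ i, ∑ j, linDeriv (planeRotation i j) (linDeriv (planeRotation i j)
      fun y => conj (polyVal P y)) x = -(2 * (k * (k + (d : ℂ) - 2))) * conj (polyVal P x) := by
  have hhom : P.IsHomogeneous k := hP.1
  have hlap : polyLaplacian d P = 0 := hP.2
  have hs := contDiff_polyVal (d := d) P
  simp only [linDeriv_conj _ hs, linDeriv_conj _ hs.linDeriv]
  have hEE : linDeriv (.id ℝ E) (linDeriv (.id ℝ E) (polyVal P)) x = k * (k * polyVal P x) := by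
    have h1 : linDeriv (.id ℝ E) (polyVal P : E → ℂ) = fun y => (k : ℂ) * polyVal P y :=
      funext (linDeriv_id_polyVal hhom)
    rw [h1, ← linDeriv_id_polyVal hhom]
    simp only [linDeriv]
    rw [fderiv_const_mul (hs.differentiable (by simp) x)]
    simp
  have := sum_linDeriv_planeRotation (hs.contDiffAt (x := x))
  rw [hEE, linDeriv_id_polyVal hhom, laplacian_polyVal, hlap] at this
  simp only [← map_sum, this]
  simp [polyVal, map_ofNat]
  ring

end HarmonicPolynomials

/-! ### Fourier-Laplace coefficients in the logarithmic variable. -/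

section RadialCoefficients

variable {d : ℕ}

local notation "E" => EuclideanSpace ℝ (Fin d)
local notation "S" => Metric.sphere (0 : EuclideanSpace ℝ (Fin d)) 1

/-- The integral of `h` over the sphere of radius `e^v`, weighted by `g`. -/
noncomputable def radialCoeff (g h : E → ℂ) (v : ℝ) : ℂ :=
  ∫ θ : S, h (Real.exp v • (θ : E)) * g θ ∂(sphereMeasure d)

variable {G : Set (EuclideanSpace ℝ (Fin d))} {I : Set ℝ}

theorem continuous_sphere_mul {f g : E → ℂ} (hf : ContinuousOn f G) (hg : Continuous g) {c : ℝ}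
    (hc : ∀ x : E, ‖x‖ = 1 → c • x ∈ G) : Continuous fun θ : S => f (c • (θ : E)) * g θ :=
  Continuous.mul (hf.comp_continuous (by fun_prop) fun θ => hc _ (by simp))
    (hg.comp continuous_subtype_val)

/-- The substitution `r = e^v` turns `d/dv` into the Euler field, a linear vector field, so
derivatives of coefficients are again coefficients. -/
theorem hasDerivAt_radialCoeff (hG : IsOpen G) (hI : IsOpen I)
    (hGI : ∀ v ∈ I, ∀ x : E, ‖x‖ = 1 → Real.exp v • x ∈ G) {g h : E → ℂ} (hg : Continuous g)
    (hh : ContDiffOn ℝ ∞ h G) {v : ℝ} (hv : v ∈ I) :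
    HasDerivAt (radialCoeff g h) (radialCoeff g (linDeriv (.id ℝ E) h) v) v := by
  have hcont : ∀ {u : E → ℂ}, ContinuousOn u G → ContinuousOn
      (Function.uncurry fun (t : ℝ) (θ : S) => u (Real.exp t • (θ : E)) * g θ) (I ×ˢ univ) := by
    intro u hu
    refine ContinuousOn.mul ?_ (Continuous.continuousOn (by fun_prop))
    refine hu.comp (f := fun p : ℝ × S => Real.exp p.1 • (p.2 : E))
      (Continuous.continuousOn (by fun_prop)) fun p hp => hGI _ hp.1 _ (by simp)
  refine hasDerivAt_integral_of_continuousOn_prod (sphereMeasure d) hI hv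
    (F := fun t θ => h (Real.exp t • (θ : E)) * g θ)
    (F' := fun t θ => linDeriv (.id ℝ E) h (Real.exp t • (θ : E)) * g θ)
    (hcont hh.continuousOn) (hcont (hh.linDeriv hG).continuousOn) fun t ht θ => ?_
  refine HasDerivAt.mul_const ?_ (g θ)
  have hfd : HasFDerivAt h (fderiv ℝ h (Real.exp t • (θ : E))) (Real.exp t • (θ : E)) :=
    ((hh.contDiffAt (hG.mem_nhds (hGI t ht θ (by simp)))).differentiableAt (by simp)).hasFDerivAt
  exact hfd.comp_hasDerivAt t ((Real.hasDerivAt_exp t).smul_const (θ : E))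

theorem contDiffOn_radialCoeff (hG : IsOpen G) (hI : IsOpen I)
    (hGI : ∀ v ∈ I, ∀ x : E, ‖x‖ = 1 → Real.exp v • x ∈ G) {g h : E → ℂ} (hg : Continuous g)
    (hh : ContDiffOn ℝ ∞ h G) : ContDiffOn ℝ ∞ (radialCoeff g h) I := by
  refine contDiffOn_infty.2 fun n => ?_
  induction n generalizing h with
  | zero =>
    exact contDiffOn_zero.2 fun v hv =>
      (hasDerivAt_radialCoeff hG hI hGI hg hh hv).continuousAt.continuousWithinAt
  | succ n ih =>
    push_cast
    refine (contDiffOn_succ_iff_deriv_of_isOpen hI).2 ⟨fun v hv =>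
      (hasDerivAt_radialCoeff hG hI hGI hg hh hv).differentiableAt.differentiableWithinAt,
      by simp, ?_⟩
    exact (ih (hh.linDeriv (A := .id ℝ E) hG)).congr fun v hv =>
      (hasDerivAt_radialCoeff hG hI hGI hg hh hv).deriv

/-- The radial form of the Laplacian in the logarithmic variable. -/
theorem radialCoeff_laplacian (hG : IsOpen G) {k : ℕ} {P : MvPolynomial (Fin d) ℂ}
    (hP : P ∈ harmonicPolys d k) {f : E → ℂ} (hf : ContDiffOn ℝ ∞ f G) {v : ℝ}
    (hv : ∀ x : E, ‖x‖ = 1 → Real.exp v • x ∈ G) :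
    (Real.exp (2 * v) : ℂ) * radialCoeff (fun x => conj (polyVal P x)) (Laplacian.laplacian f) v =
      radialCoeff (fun x => conj (polyVal P x)) (linDeriv (.id ℝ E) (linDeriv (.id ℝ E) f)) v +
      ((d : ℂ) - 2) * radialCoeff (fun x => conj (polyVal P x)) (linDeriv (.id ℝ E) f) v -
      k * (k + (d : ℂ) - 2) * radialCoeff (fun x => conj (polyVal P x)) f v := by
  set g : E → ℂ := fun x => conj (polyVal P x) with hg
  have hgs : ContDiff ℝ ∞ g :=
    Complex.conjCLE.toContinuousLinearMap.contDiff.comp (contDiff_polyVal P)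
  have hint : ∀ {u w : E → ℂ}, ContDiffOn ℝ ∞ u G → ContDiff ℝ ∞ w →
      Integrable (fun θ : S => u (Real.exp v • (θ : E)) * w θ) (sphereMeasure d) :=
    fun hu hw => (continuous_sphere_mul hu.continuousOn hw.continuous hv).integrable_sphereMeasure
  -- Two integrations by parts move both rotations onto the harmonic, where they produce its
  -- eigenvalue.
  have h1 : ∑ i, ∑ j, radialCoeff g
      (linDeriv (planeRotation i j) (linDeriv (planeRotation i j) f)) v =
      -(2 * (k * (k + (d : ℂ) - 2))) * radialCoeff g f v := by
    have : ∀ i j : Fin d, radialCoeff g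
        (linDeriv (planeRotation i j) (linDeriv (planeRotation i j) f)) v =
        ∫ θ : S, f (Real.exp v • (θ : E)) *
          linDeriv (planeRotation i j) (linDeriv (planeRotation i j) g) θ ∂(sphereMeasure d) := by
      intro i j
      have hA := inner_planeRotation_self (d := d) i j
      rw [radialCoeff, integral_linDeriv_mul hA hG (hf.linDeriv hG) hgs hv,
        integral_linDeriv_mul hA hG hf hgs.linDeriv hv, neg_neg]
    simp only [this]
    simp_rw [← integral_finsetSum Finset.univ fun j _ => hint hf (hgs.linDeriv.linDeriv)]
    rw [← integral_finsetSum Finset.univ fun i _ => integrable_finsetSum Finset.univ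
      fun j _ => hint hf (hgs.linDeriv.linDeriv)]
    simp only [← Finset.mul_sum, hg, sum_linDeriv_conj_harmonic hP]
    rw [radialCoeff, ← integral_const_mul]
    congr 1
    funext θ
    ring
  -- The same sum, now evaluated by the pointwise formula for the angular Laplacian of `f`.
  have h2 : ∑ i, ∑ j, radialCoeff g
      (linDeriv (planeRotation i j) (linDeriv (planeRotation i j) f)) v =
      2 * ((Real.exp (2 * v) : ℂ) * radialCoeff g (Laplacian.laplacian f) v -
        radialCoeff g (linDeriv (.id ℝ E) (linDeriv (.id ℝ E) f)) v -
        ((d : ℂ) - 2) * radialCoeff g (linDeriv (.id ℝ E) f) v) := by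
    unfold radialCoeff
    simp_rw [← integral_finsetSum Finset.univ fun j _ => hint ((hf.linDeriv hG).linDeriv hG) hgs]
    rw [← integral_finsetSum Finset.univ fun i _ => integrable_finsetSum Finset.univ
      fun j _ => hint ((hf.linDeriv hG).linDeriv hG) hgs]
    rw [← integral_const_mul, ← integral_const_mul, ← integral_sub, ← integral_sub,
      ← integral_const_mul]
    · congr 1
      funext θ
      simp only [← Finset.sum_mul]
      rw [sum_linDeriv_planeRotation (hf.contDiffAt (hG.mem_nhds (hv θ (by simp))))]
      have : ‖Real.exp v • (θ : E)‖ ^ 2 = Real.exp (2 * v) := by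
        rw [norm_smul]
        simp [← Real.exp_nat_mul]
      rw [this]
      ring
    · exact ((hint (hf.laplacian hG) hgs).const_mul _).sub
        (hint ((hf.linDeriv hG).linDeriv hG) hgs)
    · exact (hint (hf.linDeriv hG) hgs).const_mul _
    · exact (hint (hf.laplacian hG) hgs).const_mul _
    · exact hint ((hf.linDeriv hG).linDeriv hG) hgs
  linear_combination (1 / 2 : ℂ) * (h1 - h2)

theorem ContDiffOn.iterate_laplacian {f : E → ℂ} (hG : IsOpen G) (hf : ContDiffOn ℝ ∞ f G)
    (p : ℕ) : ContDiffOn ℝ ∞ ((fun g : E → ℂ => Laplacian.laplacian g)^[p] f) G := by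
  induction p with
  | zero => exact hf
  | succ p ih =>
    rw [Function.iterate_succ_apply']
    exact ih.laplacian hG

theorem exponent_even (d k p : ℕ) : exponent d k (2 * p) = k + 2 * p := by
  simp [exponent]

theorem exponent_odd (d k p : ℕ) : exponent d k (2 * p + 1) = -(k : ℝ) - d + 2 + 2 * p := by
  have : (2 * p + 1) / 2 = p := by omega
  simp [exponent, this]

/-- Openness of `I` lets a formula valid only on `I` be differentiated there. -/
theorem genDeriv_congr_succ {lam : ℕ → ℝ} {u φ φ' : ℝ → ℂ} {n : ℕ} (hI : IsOpen I)
    (h : ∀ v ∈ I, genDeriv lam u n v = φ v) (hφ : ∀ v ∈ I, HasDerivAt φ (φ' v) v) :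
    ∀ v ∈ I, genDeriv lam u (n + 1) v = φ' v - lam n * φ v := by
  intro v hv
  have he : genDeriv lam u n =ᶠ[𝓝 v] φ := by
    filter_upwards [hI.mem_nhds hv] with w hw using h w hw
  simp only [genDeriv, he.deriv_eq, (hφ v hv).deriv, h v hv]

/-- The generalized derivatives of the Fourier-Laplace coefficients in terms of those of the
iterated Laplacians. -/
theorem genDeriv_radialCoeff (hG : IsOpen G) (hI : IsOpen I)
    (hGI : ∀ v ∈ I, ∀ x : E, ‖x‖ = 1 → Real.exp v • x ∈ G) {k : ℕ} {P : MvPolynomial (Fin d) ℂ}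
    (hP : P ∈ harmonicPolys d k) {f : E → ℂ} (hf : ContDiffOn ℝ ∞ f G) (p : ℕ) :
    (∀ v ∈ I, genDeriv (exponent d k) (radialCoeff (fun x => conj (polyVal P x)) f) (2 * p) v =
      Real.exp (2 * p * v) * radialCoeff (fun x => conj (polyVal P x))
        ((fun g : E → ℂ => Laplacian.laplacian g)^[p] f) v) ∧
    ∀ v ∈ I, genDeriv (exponent d k) (radialCoeff (fun x => conj (polyVal P x)) f) (2 * p + 1) v =
      Real.exp (2 * p * v) * (radialCoeff (fun x => conj (polyVal P x))
        (linDeriv (.id ℝ E) ((fun g : E → ℂ => Laplacian.laplacian g)^[p] f)) v -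
        k * radialCoeff (fun x => conj (polyVal P x))
          ((fun g : E → ℂ => Laplacian.laplacian g)^[p] f) v) := by
  set g : E → ℂ := fun x => conj (polyVal P x) with hg
  have hgc : Continuous g :=
    Complex.continuous_conj.comp (contDiff_polyVal P).continuous
  have hexp : ∀ (p : ℕ) (v : ℝ), HasDerivAt (fun v : ℝ => (Real.exp (2 * p * v) : ℂ))
      (2 * p * Real.exp (2 * p * v)) v := fun p v => by
    have h : HasDerivAt (fun v : ℝ => Real.exp (2 * p * v))
        (Real.exp (2 * p * v) * (2 * p * 1)) v :=
      ((hasDerivAt_id v).const_mul _).exp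
    refine h.ofReal_comp.congr_deriv ?_
    push_cast
    ring
  -- The odd formula is one differentiation of the even one: the `2p` in `λ_{2p} = k + 2p` cancels
  -- the derivative of `e^{2pv}`.
  have hodd : ∀ p : ℕ, (∀ v ∈ I, genDeriv (exponent d k) (radialCoeff g f) (2 * p) v =
      Real.exp (2 * p * v) * radialCoeff g
        ((fun g : E → ℂ => Laplacian.laplacian g)^[p] f) v) →
      ∀ v ∈ I, genDeriv (exponent d k) (radialCoeff g f) (2 * p + 1) v =
      Real.exp (2 * p * v) * (radialCoeff g
        (linDeriv (.id ℝ E) ((fun g : E → ℂ => Laplacian.laplacian g)^[p] f)) v -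
        k * radialCoeff g ((fun g : E → ℂ => Laplacian.laplacian g)^[p] f) v) := by
    intro p h v hv
    rw [genDeriv_congr_succ hI h (fun v hv => (hexp p v).mul
      (hasDerivAt_radialCoeff hG hI hGI hgc (hf.iterate_laplacian hG p) hv)) v hv, exponent_even]
    push_cast
    ring
  suffices heven : ∀ v ∈ I, genDeriv (exponent d k) (radialCoeff g f) (2 * p) v =
      Real.exp (2 * p * v) * radialCoeff g
        ((fun g : E → ℂ => Laplacian.laplacian g)^[p] f) v from ⟨heven, hodd p heven⟩
  induction p with
  | zero => intro v _; simp [genDeriv]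
  | succ p ih =>
    intro v hv
    have hfp := hf.iterate_laplacian hG p
    have h := genDeriv_congr_succ hI (hodd p ih) (fun v hv => (hexp p v).mul
      ((hasDerivAt_radialCoeff hG hI hGI hgc (hfp.linDeriv hG) hv).sub
        ((hasDerivAt_radialCoeff hG hI hGI hgc hfp hv).const_mul (k : ℂ)))) v hv
    have hlap := radialCoeff_laplacian hG hP hfp (hGI v hv)
    have he : (Real.exp (2 * (p + 1 : ℕ) * v) : ℂ) =
        Real.exp (2 * p * v) * Real.exp (2 * v) := by
      rw [← Complex.ofReal_mul, ← Real.exp_add]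
      congr 2
      push_cast
      ring
    rw [show 2 * (p + 1) = 2 * p + 1 + 1 by ring, h, exponent_odd, he,
      Function.iterate_succ_apply']
    rw [← hg] at hlap
    push_cast at hlap ⊢
    linear_combination -Complex.exp (2 * p * v) * hlap

end RadialCoefficients

/-! ### Interpolation of the first derivative, uniformly in the degree. -/

/-- An estimate for `g' - k g` by `g` and `(d/dv - k)(d/dv + m) g` which is uniform in
`0 ≤ k ≤ m`. -/
theorem norm_deriv_sub_mul_le {k m a b M H : ℝ} (hk : 0 ≤ k) (hkm : k ≤ m) (hab : a < b)
    {g g' g'' : ℝ → ℂ} (hg : ∀ v ∈ Icc a b, HasDerivAt g (g' v) v)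
    (hg' : ∀ v ∈ Icc a b, HasDerivAt g' (g'' v) v) (hM : ∀ v ∈ Icc a b, ‖g v‖ ≤ M)
    (hH : ∀ v ∈ Icc a b, ‖g'' v + (m - k) * g' v - k * m * g v‖ ≤ H) :
    (b - a) * ‖g' b - k * g b‖ ≤ 4 * M + (b - a) ^ 2 * H := by
  have hm : 0 ≤ m := hk.trans hkm
  have haI : a ∈ Icc a b := ⟨le_rfl, hab.le⟩
  have hbI : b ∈ Icc a b := ⟨hab.le, le_rfl⟩
  have hM0 : 0 ≤ M := (norm_nonneg _).trans (hM a haI)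
  have hH0 : 0 ≤ H := (norm_nonneg _).trans (hH a haI)
  -- The integrating factor of `d/dv + m`, normalised to `1` at `b` and hence at most `1` on `[a,
  -- b]`.
  have he : ∀ v, HasDerivAt (fun v => Real.exp (m * (v - b))) (m * Real.exp (m * (v - b))) v :=
    fun v => (((hasDerivAt_id v).sub_const b).const_mul m).exp.congr_deriv (by simp; ring)
  set e : ℝ → ℂ := fun v => (Real.exp (m * (v - b)) : ℂ) with he_def
  have hec : ∀ v, HasDerivAt e (m * e v) v := fun v =>
    (he v).ofReal_comp.congr_deriv (by simp [he_def])
  have hlin : ∀ v : ℝ, HasDerivAt (fun v : ℝ => (v : ℂ) - a) 1 v := fun v =>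
    ((hasDerivAt_id v).ofReal_comp.sub_const (a : ℂ)).congr_deriv (by simp)
  -- The factor `v - a` removes the unknown `g' a`; subtracting `e * g` cancels the remaining `g'`
  -- in the derivative.
  set Γ : ℝ → ℂ := fun v => ((v : ℂ) - a) * e v * (g' v - k * g v) - e v * g v with hΓ
  have hΓ' : ∀ v ∈ Icc a b, HasDerivAt Γ
      (e v * (((v : ℂ) - a) * (g'' v + (m - k) * g' v - k * m * g v) - (k + m) * g v)) v := by
    intro v hv
    refine ((((hlin v).mul (hec v)).mul ((hg' v hv).sub ((hg v hv).const_mul (k : ℂ)))).sub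
      ((hec v).mul (hg v hv))).congr_deriv ?_
    simp only [Pi.mul_apply, Pi.sub_apply]
    ring
  -- Here `k + m ≤ 2m`, and the factor `m` is consumed by integrating `m * exp (m (v - b))`, whose
  -- integral is at most `1`. This is why the bound is uniform in `k` and `m`.
  have hBd : ∀ v, HasDerivAt (fun v => (b - a) * H * (v - a) +
      2 * M * (Real.exp (m * (v - b)) - Real.exp (m * (a - b))))
      ((b - a) * H + 2 * M * (m * Real.exp (m * (v - b)))) v := fun v =>
    ((((hasDerivAt_id v).sub_const a).const_mul _).add
      (((he v).sub_const _).const_mul _)).congr_deriv (by ring)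
  have key := image_norm_le_of_norm_deriv_right_le_deriv_boundary
    (f := fun v => Γ v - Γ a) (a := a) (b := b)
    (fun v hv => ((hΓ' v hv).sub_const _).continuousAt.continuousWithinAt)
    (fun v hv => ((hΓ' v ⟨hv.1, hv.2.le⟩).sub_const _).hasDerivWithinAt)
    (by simp) hBd (by
      intro v hv
      have hvI : v ∈ Icc a b := ⟨hv.1, hv.2.le⟩
      have hle : Real.exp (m * (v - b)) ≤ 1 :=
        Real.exp_le_one_iff.2 (mul_nonpos_of_nonneg_of_nonpos hm (by linarith [hv.2]))
      have hne : ‖e v‖ = Real.exp (m * (v - b)) := by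
        rw [he_def, Complex.norm_real, Real.norm_of_nonneg (Real.exp_pos _).le]
      have h1 : ‖((v : ℂ) - a)‖ = v - a := by
        rw [← Complex.ofReal_sub, Complex.norm_real, Real.norm_of_nonneg (by linarith [hv.1])]
      have h2 : ‖((k : ℂ) + m)‖ = k + m := by
        rw [← Complex.ofReal_add, Complex.norm_real, Real.norm_of_nonneg (by linarith)]
      have hv2 : v - a ≤ b - a := by linarith [hv.2]
      have hv1 : 0 ≤ v - a := by linarith [hv.1]
      rw [norm_mul, hne]
      calc _ ≤ Real.exp (m * (v - b)) * ((v - a) * H + (k + m) * M) := by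
            gcongr
            refine (norm_sub_le _ _).trans ?_
            rw [norm_mul, norm_mul, h1, h2]
            gcongr
            · exact hH v hvI
            · exact hM v hvI
        _ = Real.exp (m * (v - b)) * ((v - a) * H) + (k + m) * M * Real.exp (m * (v - b)) := by
            ring
        _ ≤ 1 * ((b - a) * H) + (m + m) * M * Real.exp (m * (v - b)) := by gcongr
        _ = _ := by ring) hbI
  have hΓb : Γ b = ((b - a : ℝ) : ℂ) * (g' b - k * g b) - g b := by
    simp [hΓ, he_def]
  have hΓa : Γ a = -(e a * g a) := by simp [hΓ]
  have hea : ‖e a‖ ≤ 1 := by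
    rw [he_def, Complex.norm_real, Real.norm_of_nonneg (Real.exp_pos _).le]
    exact Real.exp_le_one_iff.2 (mul_nonpos_of_nonneg_of_nonpos hm (by linarith))
  have hga : ‖e a * g a‖ ≤ M := by
    rw [norm_mul]
    calc _ ≤ 1 * M := by gcongr; exact hM a haI
      _ = M := one_mul M
  have hmain : ((b - a : ℝ) : ℂ) * (g' b - k * g b) = (Γ b - Γ a) + (g b - e a * g a) := by
    rw [hΓb, hΓa]; ring
  have hnorm : (b - a) * ‖g' b - k * g b‖ = ‖(Γ b - Γ a) + (g b - e a * g a)‖ := by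
    rw [← hmain, norm_mul, Complex.norm_real, Real.norm_of_nonneg (by linarith)]
  rw [hnorm]
  have h3 := norm_add_le (Γ b - Γ a) (g b - e a * g a)
  have h4 := norm_sub_le (g b) (e a * g a)
  have h5 := hM b hbI
  simp only [sub_self, mul_zero, Real.exp_zero] at key
  nlinarith [mul_nonneg hM0 (Real.exp_pos (m * (a - b))).le]

/-- A polynomial factor is absorbed by a larger geometric growth rate. -/
theorem natCast_mul_pow_le {s t : ℝ} (hs : 0 < s) (hst : s < t) (n : ℕ) :
    n * s ^ n ≤ s / (t - s) * t ^ n := by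
  have h := one_add_mul_le_pow (a := t / s - 1) (by linarith [div_pos (hs.trans hst) hs]) n
  have hts : 0 < t - s := sub_pos.2 hst
  rw [add_sub_cancel, div_pow, le_div_iff₀ (by positivity)] at h
  have h1 : (n : ℝ) * (t / s - 1) * s ^ n ≤ t ^ n := by
    nlinarith [pow_pos hs n]
  calc (n : ℝ) * s ^ n = s / (t - s) * ((n : ℝ) * (t / s - 1) * s ^ n) := by
        field_simp
    _ ≤ _ := by gcongr

/-! ### Bounds on coefficients, and the annulus in logarithmic coordinates. -/

section Bounds

variable {d : ℕ}

local notation "E" => EuclideanSpace ℝ (Fin d)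
local notation "S" => Metric.sphere (0 : EuclideanSpace ℝ (Fin d)) 1

/-- Integrating `|Y| ≤ (1 + |Y|²) / 2` gives a bound depending on the dimension alone. -/
theorem integral_norm_polyVal_le (P : MvPolynomial (Fin d) ℂ)
    (hP : sphereInner (polyVal P : E → ℂ) (polyVal P) = 1) :
    ∫ θ : S, ‖conj (polyVal P (θ : E))‖ ∂(sphereMeasure d) ≤
      ((sphereMeasure d).real univ + 1) / 2 := by
  have hc : Continuous fun θ : S => polyVal P (θ : E) :=
    (contDiff_polyVal P).continuous.comp continuous_subtype_val
  have hsq : ∫ θ : S, ‖polyVal P (θ : E)‖ ^ 2 ∂(sphereMeasure d) = 1 := by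
    have h : ∀ z : ℂ, z * conj z = ((‖z‖ ^ 2 : ℝ) : ℂ) := fun z => by
      rw [Complex.mul_conj, Complex.normSq_eq_norm_sq]
    simp only [sphereInner, h, integral_complex_ofReal] at hP
    exact_mod_cast hP
  have hint : ∀ {u : S → ℝ}, Continuous u → Integrable u (sphereMeasure d) := fun {u} hu => by
    obtain ⟨C, hC⟩ := isCompact_univ.exists_bound_of_continuousOn hu.continuousOn
    exact .of_bound hu.aestronglyMeasurable C (.of_forall fun x => hC x (mem_univ _))
  calc _ ≤ ∫ θ : S, (1 + ‖polyVal P (θ : E)‖ ^ 2) / 2 ∂(sphereMeasure d) := by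
        refine integral_mono (hint ?_) (hint ?_) fun θ => ?_
        · exact (Complex.continuous_conj.comp hc).norm
        · fun_prop
        · simp only [RCLike.norm_conj]
          nlinarith [sq_nonneg (‖polyVal P (θ : E)‖ - 1)]
    _ = _ := by
        rw [integral_div, integral_add (integrable_const _) (hint (by fun_prop)), hsq]
        simp

theorem norm_radialCoeff_le {P : MvPolynomial (Fin d) ℂ}
    (hP : sphereInner (polyVal P : E → ℂ) (polyVal P) = 1) {h : E → ℂ} {v M : ℝ} (hM0 : 0 ≤ M)
    (hM : ∀ θ : E, ‖θ‖ = 1 → ‖h (Real.exp v • θ)‖ ≤ M) :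
    ‖radialCoeff (fun x => conj (polyVal P x)) h v‖ ≤
      M * (((sphereMeasure d).real univ + 1) / 2) := by
  have hc : Continuous fun θ : S => conj (polyVal P (θ : E)) :=
    Complex.continuous_conj.comp ((contDiff_polyVal P).continuous.comp continuous_subtype_val)
  calc _ ≤ ∫ θ : S, M * ‖conj (polyVal P (θ : E))‖ ∂(sphereMeasure d) := by
        refine norm_integral_le_of_norm_le (hc.integrable_sphereMeasure.norm.const_mul M)
          (.of_forall fun θ => ?_)
        rw [norm_mul]
        gcongr
        exact hM θ (by simp)
    _ ≤ _ := by
        rw [integral_const_mul]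
        gcongr
        exact integral_norm_polyVal_le P hP

theorem isOpen_annulus (r₀ r₁ : ℝ≥0∞) : IsOpen (annulus d r₀ r₁) := by
  have hc : Continuous fun x : E => ENNReal.ofReal ‖x‖ :=
    ENNReal.continuous_ofReal.comp continuous_norm
  exact (isOpen_lt continuous_const hc).inter (isOpen_lt hc continuous_const)

theorem isOpen_logInterval (r₀ r₁ : ℝ≥0∞) : IsOpen (logInterval r₀ r₁) :=
  (isOpen_lt continuous_const continuous_coe_real_ereal).inter
    (isOpen_lt continuous_coe_real_ereal continuous_const)

theorem exp_smul_mem_annulus {r₀ r₁ : ℝ≥0∞} {v : ℝ} (hv : v ∈ logInterval r₀ r₁) {x : E}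
    (hx : ‖x‖ = 1) : Real.exp v • x ∈ annulus d r₀ r₁ := by
  have hn : ‖Real.exp v • x‖ = Real.exp v := by
    rw [norm_smul, hx, mul_one, Real.norm_of_nonneg (Real.exp_pos _).le]
  have hl : (v : EReal) = ENNReal.log (ENNReal.ofReal (Real.exp v)) := by
    rw [ENNReal.log_ofReal_of_pos (Real.exp_pos v), Real.log_exp]
  simp only [logInterval, mem_ofPred_eq, hl, ENNReal.log_lt_log_iff] at hv
  simpa only [annulus, mem_ofPred_eq, hn] using hv

end Bounds

/-! ### The estimate for even and odd orders. -/

theorem mainTheorem7 (d : ℕ) (hd : 2 ≤ d) (r₀ r₁ : ℝ≥0∞) (hr : r₀ < r₁)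
    (B : SphericalHarmonicBasis d) (τ : ℝ) (hτ : 0 ≤ τ)
    (f : EuclideanSpace ℝ (Fin d) → ℂ)
    (hf : PolyharmonicOfInfiniteOrder τ (annulus d r₀ r₁) f) :
    (∀ (k : ℕ) (l : Fin (harmonicDim d k)),
      ContDiffOn ℝ ∞ (logFourierLaplaceCoeff B f k l) (logInterval r₀ r₁)) ∧
    ∀ v₀ ∈ logInterval r₀ r₁, ∀ ε : ℝ, 0 < ε → ∃ C : ℝ, 0 < C ∧
      ∀ (n k : ℕ) (l : Fin (harmonicDim d k)),
        ‖genDeriv (exponent d k) (logFourierLaplaceCoeff B f k l) n v₀‖ ≤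
          C * n.factorial * (Real.exp v₀ * (τ + ε)) ^ n := by
  obtain ⟨hfs, hfb⟩ := hf
  have hG := isOpen_annulus (d := d) r₀ r₁
  have hI := isOpen_logInterval r₀ r₁
  have hGI : ∀ v ∈ logInterval r₀ r₁, ∀ x : EuclideanSpace ℝ (Fin d), ‖x‖ = 1 →
      Real.exp v • x ∈ annulus d r₀ r₁ := fun v hv x hx => exp_smul_mem_annulus hv hx
  refine ⟨fun k l => contDiffOn_radialCoeff hG hI hGI
    (Complex.continuous_conj.comp (contDiff_polyVal _).continuous) hfs, ?_⟩
  intro v₀ hv₀ ε hε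
  -- The interpolation estimate is applied at the right endpoint of `[v₀ - δ, v₀]`, so only the
  -- shell of radii `e^v` with `v` in that interval is needed.
  obtain ⟨δ, hδ, hball⟩ := Metric.nhds_basis_closedBall.mem_iff.1 (hI.mem_nhds hv₀)
  have hsub : Icc (v₀ - δ) v₀ ⊆ logInterval r₀ r₁ := fun v hv =>
    hball (by rw [Real.closedBall_eq_Icc]; exact ⟨hv.1, by linarith [hv.2]⟩)
  have hK : IsCompact ((fun p : ℝ × EuclideanSpace ℝ (Fin d) => Real.exp p.1 • p.2) ''
      (Icc (v₀ - δ) v₀ ×ˢ Metric.sphere 0 1)) :=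
    (isCompact_Icc.prod (isCompact_sphere _ _)).image (by fun_prop)
  obtain ⟨C₁, hC₁, hbound⟩ := hfb _ (by
    rintro _ ⟨⟨v, θ⟩, ⟨hv, hθ⟩, rfl⟩
    exact hGI v (hsub hv) θ (by simpa using hθ)) hK (ε / 2) (by positivity)
  set s := τ + ε / 2 with hs_def
  set t := τ + ε with ht_def
  have hs : 0 < s := by positivity
  have hst : s < t := by simp only [hs_def, ht_def]; linarith
  have ht : 0 < t := hs.trans hst
  set W := ((sphereMeasure d).real univ + 1) / 2 with hW_def
  have hW : 0 < W := by positivity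
  have hcoeff : ∀ (p k : ℕ) (l : Fin (harmonicDim d k)), ∀ v ∈ Icc (v₀ - δ) v₀,
      ‖radialCoeff (fun x => conj (polyVal (B.Y k l : MvPolynomial (Fin d) ℂ) x))
        ((fun g : EuclideanSpace ℝ (Fin d) → ℂ => Laplacian.laplacian g)^[p] f) v‖ ≤
      C₁ * (2 * p).factorial * s ^ (2 * p) * W := fun p k l v hv =>
    norm_radialCoeff_le (by simpa using B.orthonormal k l l) (by positivity)
      fun θ hθ => hbound p _ ⟨(v, θ), ⟨hv, by simpa using hθ⟩, rfl⟩
  have hexp : ∀ p : ℕ, Real.exp (2 * p * v₀) = Real.exp v₀ ^ (2 * p) := fun p => by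
    rw [← Real.exp_nat_mul]; push_cast; rfl
  have hv₀I : v₀ ∈ Icc (v₀ - δ) v₀ := ⟨by linarith, le_rfl⟩
  have hts : 0 < t - s := sub_pos.2 hst
  set x := Real.exp v₀ with hx_def
  have hx : 0 < x := Real.exp_pos v₀
  set Cₑ := C₁ * W with hCₑ
  -- The interpolation bound divided by `δ`, then by `x * t ^ (2 * q + 1)`: the first term has `t ^
  -- (2 * q)` and no power of `x`, the second `x ^ 2 * t ^ (2 * q + 2)`.
  set Cₒ := 4 * (C₁ * W) / (δ * (x * t)) + δ * x * (C₁ * W) * (s / (t - s)) * t with hCₒ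
  have hCₑ0 : 0 < Cₑ := by positivity
  have hCₒ0 : 0 < Cₒ := by positivity
  refine ⟨Cₑ + Cₒ, by positivity, fun n k l => ?_⟩
  change ‖genDeriv (exponent d k) (radialCoeff
    (fun x => conj (polyVal (B.Y k l : MvPolynomial (Fin d) ℂ) x)) f) n v₀‖ ≤ _
  obtain ⟨q, hq⟩ := Nat.even_or_odd' n
  obtain ⟨heven, hodd⟩ := genDeriv_radialCoeff hG hI hGI (B.Y k l).2 hfs q
  rcases hq with hq | hq
  · rw [hq, heven v₀ hv₀, norm_mul, Complex.norm_real, Real.norm_of_nonneg (Real.exp_pos _).le,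
      hexp]
    calc _ ≤ x ^ (2 * q) * (C₁ * (2 * q).factorial * s ^ (2 * q) * W) := by
          gcongr; exact hcoeff q k l v₀ hv₀I
      _ ≤ x ^ (2 * q) * (C₁ * (2 * q).factorial * t ^ (2 * q) * W) := by gcongr
      _ = Cₑ * (2 * q).factorial * (x * t) ^ (2 * q) := by rw [mul_pow]; ring
      _ ≤ _ := by gcongr; linarith
  · rw [hq, hodd v₀ hv₀, norm_mul, Complex.norm_real, Real.norm_of_nonneg (Real.exp_pos _).le,
      hexp]
    have hfq := hfs.iterate_laplacian hG q
    have hgc : Continuous fun x : EuclideanSpace ℝ (Fin d) =>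
        conj (polyVal (B.Y k l : MvPolynomial (Fin d) ℂ) x) :=
      Complex.continuous_conj.comp (contDiff_polyVal _).continuous
    have hd' : (2 : ℝ) ≤ d := by exact_mod_cast hd
    -- With `m = k + d - 2`, the condition `k ≤ m` is `d ≥ 2`. The value of `H` bounds the
    -- coefficient of `e^{2v} Δ^{q+1} f`, as `e^{2v} ≤ x²` for `v ≤ v₀`.
    have hmain := norm_deriv_sub_mul_le (k := k) (m := k + d - 2) (a := v₀ - δ) (b := v₀)
      (M := C₁ * (2 * q).factorial * s ^ (2 * q) * W)
      (H := x ^ 2 * (C₁ * (2 * (q + 1)).factorial * s ^ (2 * (q + 1)) * W))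
      (Nat.cast_nonneg k) (by linarith) (by linarith)
      (fun v hv => hasDerivAt_radialCoeff hG hI hGI hgc hfq (hsub hv))
      (fun v hv => hasDerivAt_radialCoeff hG hI hGI hgc (hfq.linDeriv hG) (hsub hv))
      (hcoeff q k l) (by
        intro v hv
        have hlap := radialCoeff_laplacian hG (B.Y k l).2 hfq (hGI v (hsub hv))
        have hc := hcoeff (q + 1) k l v hv
        rw [Function.iterate_succ_apply'] at hc
        have hexp2 : Real.exp (2 * v) ≤ x ^ 2 := by
          rw [hx_def, ← Real.exp_nat_mul]
          exact Real.exp_le_exp.2 (by push_cast; linarith [hv.2])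
        calc _ = ‖(Real.exp (2 * v) : ℂ) * radialCoeff
              (fun x => conj (polyVal (B.Y k l : MvPolynomial (Fin d) ℂ) x))
              (Laplacian.laplacian ((fun g : EuclideanSpace ℝ (Fin d) → ℂ =>
                Laplacian.laplacian g)^[q] f)) v‖ := by
              rw [hlap]
              congr 1
              push_cast
              ring
          _ ≤ _ := by
              rw [norm_mul, Complex.norm_real, Real.norm_of_nonneg (Real.exp_pos _).le]
              gcongr)
    rw [sub_sub_cancel] at hmain
    set u := ‖radialCoeff (fun x => conj (polyVal (B.Y k l : MvPolynomial (Fin d) ℂ) x))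
      (linDeriv (.id ℝ _) ((fun g : EuclideanSpace ℝ (Fin d) → ℂ =>
        Laplacian.laplacian g)^[q] f)) v₀ - k * radialCoeff
      (fun x => conj (polyVal (B.Y k l : MvPolynomial (Fin d) ℂ) x))
        ((fun g : EuclideanSpace ℝ (Fin d) → ℂ => Laplacian.laplacian g)^[q] f) v₀‖
    have hfac : ((2 * (q + 1)).factorial : ℝ) = (2 * (q + 1) : ℕ) * (2 * q + 1).factorial := by
      rw [show 2 * (q + 1) = (2 * q + 1) + 1 by ring, Nat.factorial_succ]; push_cast; ring
    have hfac' : ((2 * q).factorial : ℝ) ≤ (2 * q + 1).factorial := by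
      exact_mod_cast Nat.factorial_le (by omega)
    have hgrow := natCast_mul_pow_le hs hst (2 * (q + 1))
    have h1 : 4 * (C₁ * (2 * q).factorial * s ^ (2 * q) * W) ≤
        4 * (C₁ * (2 * q + 1).factorial * t ^ (2 * q) * W) := by gcongr
    -- The surplus factor `2q + 2` in the factorial is traded for the passage from `s` to `t`.
    have h2 : δ ^ 2 * (x ^ 2 * (C₁ * (2 * (q + 1)).factorial * s ^ (2 * (q + 1)) * W)) ≤
        δ ^ 2 * x ^ 2 * C₁ * W * (2 * q + 1).factorial * (s / (t - s) * t ^ (2 * (q + 1))) := by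
      rw [hfac]
      calc _ = δ ^ 2 * x ^ 2 * C₁ * W * (2 * q + 1).factorial *
            ((2 * (q + 1) : ℕ) * s ^ (2 * (q + 1))) := by ring
        _ ≤ _ := by gcongr
    have hu : u ≤ Cₒ * (2 * q + 1).factorial * x * t ^ (2 * q + 1) := by
      refine le_of_mul_le_mul_left ((hmain.trans (add_le_add h1 h2)).trans_eq ?_) hδ
      rw [hCₒ]
      field_simp
      ring
    calc x ^ (2 * q) * u ≤ x ^ (2 * q) * (Cₒ * (2 * q + 1).factorial * x * t ^ (2 * q + 1)) := by
          gcongr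
      _ = Cₒ * (2 * q + 1).factorial * (x * t) ^ (2 * q + 1) := by rw [mul_pow]; ring
      _ ≤ _ := by gcongr; linarith
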